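/- A hypergraph is a pair $(V,E)$ with $V$ a finite set and $E$ a set of subsets of $V$, each of cardinality at least $2$. A walk of length $k\ge 0$ is a sequence $(v_0,e_1,v_1,\dots,e_k,v_k)$ of vertices $v_i\in V$ and hyperedges $e_i\in E$ with $v_{i-1},v_i\in e_i$ for $1\le i\le k$; it is a cycle if $k\ge 2$, $v_k=v_0$, the vertices $v_0,\dots,v_{k-1}$ are distinct and the hyperedges $e_1,\dots,e_k$ are distinct. A hyperforest is a hypergraph without cycles; its connected components (with respect to being joined by a walk) are its hypertrees. A rooted spanning hyperforest of a hypergraph $G=(V,E)$ is a hyperforest $(V,F)$ with $F\subseteq E$, together with the choice of one vertex (the root) in each of its hypertrees. For $n\ge 1$ let $\overline{\mathcal K}_n$ be the complete hypergraph on $n$ labelled vertices, whose hyperedges are all the subsets of at least two vertices. Let $S(s,m)$ be the Stirling numbers of the second kind and $b_s(x)=\sum_{m\ge 0}S(s,m)\,x^m$ the Bell polynomials. Then, for all integers $1\le r\le n$, the number of rooted spanning hyperforests of $\overline{\mathcal K}_n$ with exactly $r$ hypertrees (each hyperforest being counted with weight $1$) is $$t_{n,r}=\binom{n-1}{r-1}\,b_{n-r}(n)=\binom{n-1}{r-1}\sum_{m\ge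 0}S(n-r,m)\,n^m ,$$ and the total number of rooted spanning hyperforests of $\overline{\mathcal K}_n$ is $$\sum_{r=1}^{n}\binom{n-1}{r-1}\,b_{n-r}(n)=\frac{b_n(n)}{n}.$$ -/

import Mathlib

namespace Hypergraph

/-- The alternating sequence `(v₀, e₁, v₁, e₂, v₂, …, e_k, v_k)` (here `e₁, …, e_k` are
`e 0, …, e (k - 1)`) is a walk of length `k` in `H`: the `v i` are vertices, the `e i` are
hyperedges, and each hyperedge contains the vertices just before and just after it. -/
structure IsWalk {α : Type*} (H : Hypergraph α) {k : ℕ} (v : Fin (k + 1) → α)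
    (e : Fin k → Set α) : Prop where
  vertex_mem : ∀ i, v i ∈ H.vertexSet
  edge_mem : ∀ i, e i ∈ H.edgeSet
  left_mem : ∀ i : Fin k, v i.castSucc ∈ e i
  right_mem : ∀ i : Fin k, v i.succ ∈ e i

/-- A cycle is a closed walk of length `k ≥ 2` with `v₀, …, v_{k-1}` distinct vertices and
`e₁, …, e_k` distinct hyperedges. -/
structure IsCycle {α : Type*} (H : Hypergraph α) {k : ℕ} (v : Fin (k + 1) → α)
    (e : Fin k → Set α) : Prop where
  isWalk : H.IsWalk v e
  two_le : 2 ≤ k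
  closed : v (Fin.last k) = v 0
  vertex_injective : Function.Injective fun i : Fin k => v i.castSucc
  edge_injective : Function.Injective e

/-- A hyperforest is a hypergraph without cycles. -/
def IsHyperforest {α : Type*} (H : Hypergraph α) : Prop :=
  ∀ (k : ℕ) (v : Fin (k + 1) → α) (e : Fin k → Set α), ¬ H.IsCycle v e

/-- Two vertices are joined by a walk (of some length `k ≥ 0`). -/
def WalkConnected {α : Type*} (H : Hypergraph α) (x y : α) : Prop :=
  ∃ (k : ℕ) (v : Fin (k + 1) → α) (e : Fin k → Set α),
    H.IsWalk v e ∧ v 0 = x ∧ v (Fin.last k) = y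

/-- The vertex sets of the connected components of `H`: the classes of vertices under the relation
of being joined by a walk. In a hyperforest these are the vertex sets of its hypertrees. -/
def componentSets {α : Type*} (H : Hypergraph α) : Set (Set α) :=
  {C | ∃ x ∈ H.vertexSet, C = {y | H.WalkConnected x y}}

/-- `F` is a spanning sub-hypergraph of `G`. -/
def IsSpanningSub {α : Type*} (F G : Hypergraph α) : Prop :=
  F.vertexSet = G.vertexSet ∧ F.edgeSet ⊆ G.edgeSet

/-- The rooted spanning hyperforests of `G`: pairs `(F, R)` of a spanning sub-hypergraph `F` of `G`
that is a hyperforest and a set `R` of vertices (the roots) that has exactly one element in every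
connected component (hypertree) of `F`. -/
def rootedSpanningHyperforests {α : Type*} (G : Hypergraph α) : Set (Hypergraph α × Set α) :=
  {p | p.1.IsSpanningSub G ∧ p.1.IsHyperforest ∧ p.2 ⊆ p.1.vertexSet ∧
    ∀ C ∈ p.1.componentSets, ∃! x, x ∈ p.2 ∧ x ∈ C}

/-- The rooted spanning hyperforests of `G` that consist of exactly `r` hypertrees. -/
def rootedSpanningHyperforestsWith {α : Type*} (G : Hypergraph α) (r : ℕ) :
    Set (Hypergraph α × Set α) :=
  {p | p ∈ G.rootedSpanningHyperforests ∧ p.1.componentSets.ncard = r}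

/-- The complete hypergraph on the `n` vertices `0, …, n - 1`: its hyperedges are all the sets of
at least two vertices. -/
def completeHypergraph (n : ℕ) : Hypergraph (Fin n) where
  vertexSet := Set.univ
  edgeSet := {A | 2 ≤ A.ncard}
  subset_vertexSet_of_mem_edgeSet' := fun _ _ => Set.subset_univ _

end Hypergraph

/-- The Bell (exponential) polynomial `b_s(x) = ∑_{m ≥ 0} S(s, m) x ^ m`; the terms with `m > s`
vanish. -/
noncomputable def bellPolynomial (s : ℕ) : Polynomial ℕ :=
  ∑ m ∈ Finset.range (s + 1), Polynomial.C (Nat.stirlingSecond s m) * Polynomial.X ^ m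

/-! Let a(m, r) be the number of rooted hyperforests on n vertices with m hyperedges and r roots.
Double-count those with m + 1 hyperedges, one of them marked. Deleting the marked hyperedge f
detaches every vertex of f except the one, p, still joined to the old root; the other vertices, B,
become roots of their own hypertrees. Conversely, any vertex p and any k ≥ 1 roots outside the
hypertree of p can be joined by a hyperedge (`insert_edge`, `erase_edge`). Hence (m + 1) a(m + 1, r)
= ∑ₖ a(m, r + k) · n · C(r + k - 1, k), which is `rootedFinset_succ`. With a(0, r) = [r = n] and (m
+ 1) S(N, m + 1) = ∑ₖ C(N, k) S(N - k, m), induction on m gives a(m, r) = C(n - 1, r - 1) S(n - r,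
m) nᵐ (`card_rootedFinset`). Summing over m gives the Bell polynomial; summing over r gives the
total, by the recurrence b_{N+1}(x) = x ∑ₖ C(N, k) b_k(x). -/

namespace Hypergraph

/-! ### Cycles and reachability in the link graph -/

variable {V : Type*}

/-- The hypergraph on all of `V` with the given finite family of hyperedges. -/
def ofEdges (E : Finset (Finset V)) : Hypergraph V where
  vertexSet := Set.univ
  edgeSet := {A | ∃ f ∈ E, A = (f : Set V)}
  subset_vertexSet_of_mem_edgeSet' := fun _ _ => Set.subset_univ _

/-- The graph joining any two distinct vertices that lie in a common hyperedge. -/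
def linkGraph (E : Finset (Finset V)) : SimpleGraph V where
  Adj x y := x ≠ y ∧ ∃ f ∈ E, x ∈ f ∧ y ∈ f
  symm := ⟨fun _ _ ⟨h, f, hf, hx, hy⟩ => ⟨h.symm, f, hf, hy, hx⟩⟩
  loopless := ⟨fun _ h => h.1 rfl⟩

theorem linkGraph_mono {E E' : Finset (Finset V)} (h : E ⊆ E') : linkGraph E ≤ linkGraph E' :=
  fun _ _ ⟨hne, f, hf, hxy⟩ => ⟨hne, f, h hf, hxy⟩

theorem reachable_of_mem {E : Finset (Finset V)} {f : Finset V} (hf : f ∈ E) {x y : V}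
    (hx : x ∈ f) (hy : y ∈ f) : (linkGraph E).Reachable x y := by
  by_cases h : x = y
  · rw [h]
  · exact SimpleGraph.Adj.reachable ⟨h, f, hf, hx, hy⟩

theorem reachable_of_forall_step (G : SimpleGraph V) (u : ℕ → V) {a b : ℕ} (hab : a ≤ b)
    (h : ∀ i, a ≤ i → i < b → G.Reachable (u i) (u (i + 1))) : G.Reachable (u a) (u b) := by
  induction b, hab using Nat.le_induction with
  | base => exact SimpleGraph.Reachable.refl _
  | succ b hab ih =>
    exact (ih fun i hi hib => h i hi (by omega)).trans (h b hab (by omega))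

theorem exists_edges_of_walk {E : Finset (Finset V)} {x y : V} (p : (linkGraph E).Walk x y) :
    ∃ f : Fin p.length → Finset V,
      ∀ i, f i ∈ E ∧ p.getVert i ∈ f i ∧ p.getVert (i + 1) ∈ f i := by
  have h : ∀ i : Fin p.length, ∃ f, f ∈ E ∧ p.getVert i ∈ f ∧ p.getVert (i + 1) ∈ f :=
    fun i => (p.adj_getVert_succ i.2).2
  choose f hf using h
  exact ⟨f, hf⟩

theorem finOfNat_eq {k i : ℕ} (h : i < k + 1) : Fin.ofNat (k + 1) i = ⟨i, h⟩ :=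
  Fin.ext (Nat.mod_eq_of_lt h)

theorem walkConnected_ofEdges_iff {E : Finset (Finset V)} {x y : V} :
    (ofEdges E).WalkConnected x y ↔ (linkGraph E).Reachable x y := by
  constructor
  · rintro ⟨k, v, e, hw, rfl, rfl⟩
    -- The wrap-around of `Fin.ofNat` is harmless: only indices at most k occur.
    have := reachable_of_forall_step (linkGraph E) (fun i => v (Fin.ofNat (k + 1) i))
      (Nat.zero_le k) fun i _ hi => by
        obtain ⟨f, hf, hef⟩ := hw.edge_mem ⟨i, hi⟩
        have h1 := hw.left_mem ⟨i, hi⟩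
        have h2 := hw.right_mem ⟨i, hi⟩
        rw [hef] at h1 h2
        rw [finOfNat_eq (Nat.lt_succ_of_lt hi), finOfNat_eq (Nat.succ_lt_succ hi)]
        exact reachable_of_mem hf h1 h2
    rwa [finOfNat_eq (Nat.lt_succ_self k), finOfNat_eq (Nat.succ_pos k)] at this
  · rintro ⟨p⟩
    obtain ⟨f, hf⟩ := exists_edges_of_walk p
    refine ⟨p.length, fun i => p.getVert i, fun i => f i,
      ⟨fun _ => Set.mem_univ _, fun i => ⟨f i, (hf i).1, rfl⟩, fun i => (hf i).2.1,
        fun i => (hf i).2.2⟩, by simp, by simp⟩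

theorem dist_getVert {G : SimpleGraph V} {x y : V} (p : G.Walk x y) (hp : p.length = G.dist x y)
    {i : ℕ} (hi : i ≤ p.length) : G.dist x (p.getVert i) = i := by
  have h1 := SimpleGraph.dist_le (p.take i)
  have h2 := SimpleGraph.dist_le (p.drop i)
  have h3 : G.dist x y ≤ G.dist x (p.getVert i) + G.dist (p.getVert i) y :=
    SimpleGraph.Reachable.dist_triangle_left ⟨p.take i⟩ _
  simp only [SimpleGraph.Walk.take_length, SimpleGraph.Walk.drop_length] at h1 h2
  omega

/-- A shortest path from x to y, closed up by f, would be a cycle: distances from x separate its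
vertices, and a repeated hyperedge would be a shortcut. -/
theorem not_reachable_of_isHyperforest_insert [DecidableEq V] {E : Finset (Finset V)}
    {f : Finset V} (hf : f ∉ E) (h : (ofEdges (insert f E)).IsHyperforest) {x y : V} (hx : x ∈ f)
    (hy : y ∈ f) (hxy : x ≠ y) : ¬ (linkGraph E).Reachable x y := by
  intro hr
  obtain ⟨p, hp⟩ := hr.exists_walk_length_eq_dist
  obtain ⟨g, hg⟩ := exists_edges_of_walk p
  have hpos : 0 < p.length := by
    rw [hp]; exact hr.pos_dist_of_ne hxy
  have hd : ∀ i ≤ p.length, (linkGraph E).dist x (p.getVert i) = i := fun i hi =>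
    dist_getVert p hp hi
  have hne : ∀ i j : Fin p.length, i < j → g i ≠ g j := by
    intro i j hij he
    have h1 := (hg i).2.1
    have h2 := (hg j).2.2
    rw [← he] at h2
    have h3 : (linkGraph E).Reachable x (p.getVert i) := ⟨p.take i⟩
    have h4 := h3.dist_triangle_left (p.getVert (j + 1))
    have h5 : (linkGraph E).dist (p.getVert i) (p.getVert (j + 1)) ≤ 1 := by
      by_cases hq : p.getVert i = p.getVert (j + 1)
      · rw [hq]; simp
      · exact (SimpleGraph.dist_eq_one_iff_adj.2 (show (linkGraph E).Adj _ _ from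
          ⟨hq, g i, (hg i).1, h1, h2⟩)).le
    rw [hd _ (by omega), hd _ (by omega)] at h4
    have : (i : ℕ) < j := hij
    omega
  refine h (p.length + 1) (Fin.snoc (fun i : Fin (p.length + 1) => p.getVert i) x)
    (Fin.snoc (fun i => (g i : Set V)) (f : Set V)) ⟨⟨fun _ => Set.mem_univ _, ?_, ?_, ?_⟩,
      by omega, ?_, ?_, ?_⟩
  · intro i
    refine Fin.lastCases ?_ (fun i => ?_) i
    · exact ⟨f, by simp, by simp⟩
    · exact ⟨g i, by simp [(hg i).1], by simp⟩
  · intro i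
    refine Fin.lastCases ?_ (fun i => ?_) i
    · simpa using hy
    · simpa using (hg i).2.1
  · intro i
    refine Fin.lastCases ?_ (fun i => ?_) i
    · simpa [Fin.succ_last] using hx
    · rw [Fin.succ_castSucc, Fin.snoc_castSucc, Fin.snoc_castSucc]
      simpa using (hg i).2.2
  · rw [Fin.snoc_last, ← Fin.castSucc_zero, Fin.snoc_castSucc]
    simp
  · intro i j hij
    simp only [Fin.snoc_castSucc] at hij
    have h1 := hd i (by omega)
    rw [hij, hd j (by omega)] at h1
    exact Fin.ext h1.symm
  · have hfg : ∀ i, g i ≠ f := fun i hi => hf (hi ▸ (hg i).1)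
    intro i j
    refine Fin.lastCases ?_ (fun i => ?_) i <;> refine Fin.lastCases ?_ (fun j => ?_) j
    · simp
    · simpa using fun h => (hfg j h.symm).elim
    · simpa using fun h => (hfg i h).elim
    · intro hij
      simp only [Fin.snoc_castSucc, Finset.coe_inj] at hij
      rcases lt_trichotomy i j with hl | rfl | hl
      · exact (hne _ _ hl hij).elim
      · rfl
      · exact (hne _ _ hl hij.symm).elim

theorem isHyperforest_mono {E E' : Finset (Finset V)} (hE : E ⊆ E')
    (h : (ofEdges E').IsHyperforest) : (ofEdges E).IsHyperforest := by
  rintro k v e ⟨hw, h2, hc, hv, he⟩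
  refine h k v e ⟨⟨hw.vertex_mem, fun i => ?_, hw.left_mem, hw.right_mem⟩, h2, hc, hv, he⟩
  obtain ⟨f, hf, hef⟩ := hw.edge_mem i
  exact ⟨f, hE hf, hef⟩

/-- A new cycle must use f exactly once; the rest of it joins two cyclically consecutive vertices of
f inside E, so these coincide, which is impossible for length at least 2. -/
theorem isHyperforest_insert [DecidableEq V] {E : Finset (Finset V)}
    {f : Finset V} (h : (ofEdges E).IsHyperforest)
    (hne : ∀ x ∈ f, ∀ y ∈ f, (linkGraph E).Reachable x y → x = y) :
    (ofEdges (insert f E)).IsHyperforest := by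
  rintro k v e ⟨hw, h2, hc, hv, he⟩
  by_cases hex : ∃ i, e i = (f : Set V)
  · obtain ⟨i, hi⟩ := hex
    have hother : ∀ j, j ≠ i → (linkGraph E).Reachable (v j.castSucc) (v j.succ) := by
      intro j hj
      obtain ⟨g, hg, hjg⟩ := hw.edge_mem j
      rcases Finset.mem_insert.1 hg with rfl | hg
      · exact (hj (he (hjg.trans hi.symm))).elim
      have h1 := hw.left_mem j
      have h2 := hw.right_mem j
      rw [hjg] at h1 h2
      exact reachable_of_mem hg h1 h2
    set u : ℕ → V := fun j => v (Fin.ofNat (k + 1) j) with hu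
    have huv : ∀ j (hj : j < k + 1), u j = v ⟨j, hj⟩ := fun j hj => by
      simp only [hu, finOfNat_eq hj]
    have hstep : ∀ j, j < k → j ≠ i → (linkGraph E).Reachable (u j) (u (j + 1)) := by
      intro j hj hji
      have := hother ⟨j, hj⟩ fun h => hji (by rw [← h])
      rwa [huv j (by omega), huv (j + 1) (by omega)]
    have hi' := i.2
    have r1 : (linkGraph E).Reachable (u 0) (u i) :=
      reachable_of_forall_step _ u (Nat.zero_le _) fun j _ hj => hstep j (by omega) (by omega)
    have r2 : (linkGraph E).Reachable (u (i + 1)) (u k) :=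
      reachable_of_forall_step _ u hi' fun j hj hjk => hstep j (by omega) (by omega)
    have e1 : u i = v i.castSucc := huv _ _
    have e2 : u (i + 1) = v i.succ := huv _ _
    have e3 : u k = u 0 := by
      rw [huv k (by omega), huv 0 (by omega)]
      exact hc
    have hm1 := hw.left_mem i
    have hm2 := hw.right_mem i
    rw [hi, ← e1] at hm1
    rw [hi, ← e2] at hm2
    have heq := hne _ hm2 _ hm1 (r2.trans (e3 ▸ r1))
    have hinj : ∀ a b, a < k → b < k → u a = u b → a = b := by
      intro a b ha hb hab
      have : (⟨a, ha⟩ : Fin k) = ⟨b, hb⟩ := by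
        apply hv
        rwa [huv a (by omega), huv b (by omega)] at hab
      simpa using this
    -- Distinctness covers only indices below k, so index k must first be replaced by 0.
    rcases Nat.lt_or_ge (i + 1) k with hlt | hge
    · have := hinj _ _ hlt hi' heq
      omega
    · have hk : (i : ℕ) + 1 = k := by omega
      rw [hk, e3] at heq
      have := hinj _ _ (by omega) hi' heq
      omega
  · refine h k v e ⟨⟨hw.vertex_mem, fun i => ?_, hw.left_mem, hw.right_mem⟩, h2, hc, hv, he⟩
    obtain ⟨g, hg, hig⟩ := hw.edge_mem i
    rcases Finset.mem_insert.1 hg with rfl | hg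
    · exact (hex ⟨i, hig⟩).elim
    · exact ⟨g, hg, hig⟩

end Hypergraph

/-! ### Attaching and removing a hyperedge of a rooted hyperforest -/

namespace Hypergraph

variable {V : Type*}

/-- A walk using f reaches f within E before its first use and leaves f within E after its last. -/
theorem reachable_insert [DecidableEq V] {E : Finset (Finset V)} {f : Finset V} {x y : V}
    (h : (linkGraph (insert f E)).Reachable x y) :
    (linkGraph E).Reachable x y ∨
      (∃ a ∈ f, (linkGraph E).Reachable x a) ∧ ∃ b ∈ f, (linkGraph E).Reachable y b := by
  obtain ⟨p⟩ := h
  induction p with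
  | nil => exact Or.inl (SimpleGraph.Reachable.refl _)
  | @cons u v w hadj p ih =>
    obtain ⟨-, g, hg, hu, hv⟩ := hadj
    rcases Finset.mem_insert.1 hg with rfl | hg
    · refine Or.inr ⟨⟨u, hu, SimpleGraph.Reachable.refl _⟩, ?_⟩
      rcases ih with ih | ih
      · exact ⟨v, hv, ih.symm⟩
      · exact ih.2
    · have huv := reachable_of_mem hg hu hv
      rcases ih with ih | ⟨⟨a, ha, hva⟩, hb⟩
      · exact Or.inl (huv.trans ih)
      · exact Or.inr ⟨⟨a, ha, huv.trans hva⟩, hb⟩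

/-- `E` is the edge set of a hyperforest on all of `V`, and `R` is a choice of one root in each of
its hypertrees. -/
structure IsRooted (E : Finset (Finset V)) (R : Finset V) : Prop where
  two_le_card : ∀ f ∈ E, 2 ≤ f.card
  isHyperforest : (ofEdges E).IsHyperforest
  existsUnique_root : ∀ x, ∃! s, s ∈ R ∧ (linkGraph E).Reachable x s

namespace IsRooted

variable {E : Finset (Finset V)} {R : Finset V}

theorem eq_of_reachable (h : IsRooted E R) {s t : V} (hs : s ∈ R) (ht : t ∈ R)
    (hst : (linkGraph E).Reachable s t) : s = t :=
  (h.existsUnique_root s).unique ⟨hs, SimpleGraph.Reachable.refl _⟩ ⟨ht, hst⟩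

theorem notMem_of_forall_not_reachable {p : V} {B : Finset V}
    (hp : ∀ b ∈ B, ¬ (linkGraph E).Reachable p b) : p ∉ B :=
  fun h => hp p h (SimpleGraph.Reachable.refl _)

variable [DecidableEq V]

theorem eq_of_mem_insert (h : IsRooted E R) {p : V} {B : Finset V} (hB : B ⊆ R)
    (hp : ∀ b ∈ B, ¬ (linkGraph E).Reachable p b) :
    ∀ x ∈ insert p B, ∀ y ∈ insert p B, (linkGraph E).Reachable x y → x = y := by
  intro x hx y hy hxy
  rcases Finset.mem_insert.1 hx with hx' | hx' <;> rcases Finset.mem_insert.1 hy with hy' | hy'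
  · rw [hx', hy']
  · exact (hp _ hy' (hx' ▸ hxy)).elim
  · exact (hp _ hx' (hy' ▸ hxy.symm)).elim
  · exact h.eq_of_reachable (hB hx') (hB hy') hxy

theorem insert_notMem {p : V} {B : Finset V} (hB : B.Nonempty)
    (hp : ∀ b ∈ B, ¬ (linkGraph E).Reachable p b) : insert p B ∉ E := by
  intro hE
  obtain ⟨b, hb⟩ := hB
  exact hp b hb (reachable_of_mem hE (Finset.mem_insert_self _ _) (Finset.mem_insert_of_mem hb))

/-- Merging the hypertrees of the roots `B` into the hypertree of `p` by a new hyperedge. -/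
theorem insert_edge (h : IsRooted E R) {p : V} {B : Finset V} (hB : B ⊆ R) (hne : B.Nonempty)
    (hp : ∀ b ∈ B, ¬ (linkGraph E).Reachable p b) :
    IsRooted (insert (insert p B) E) (R \ B) := by
  have hpB : p ∉ B := notMem_of_forall_not_reachable hp
  refine ⟨fun f hf => ?_, isHyperforest_insert h.isHyperforest (h.eq_of_mem_insert hB hp),
    fun x => ?_⟩
  · rcases Finset.mem_insert.1 hf with rfl | hf
    · rw [Finset.card_insert_of_notMem hpB]
      have := hne.card_pos
      omega
    · exact h.two_le_card f hf
  · have hmono := linkGraph_mono (Finset.subset_insert (insert p B) E)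
    apply existsUnique_of_exists_of_unique
    · obtain ⟨s, ⟨hs, hxs⟩, -⟩ := h.existsUnique_root x
      by_cases hsB : s ∈ B
      · obtain ⟨t, ⟨ht, hpt⟩, -⟩ := h.existsUnique_root p
        refine ⟨t, Finset.mem_sdiff.2 ⟨ht, fun htB => hp t htB hpt⟩, ?_⟩
        exact ((hxs.mono hmono).trans (reachable_of_mem (Finset.mem_insert_self _ _)
          (Finset.mem_insert_of_mem hsB) (Finset.mem_insert_self _ _))).trans (hpt.mono hmono)
      · exact ⟨s, Finset.mem_sdiff.2 ⟨hs, hsB⟩, hxs.mono hmono⟩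
    · rintro s t ⟨hs, hxs⟩ ⟨ht, hxt⟩
      rw [Finset.mem_sdiff] at hs ht
      -- A surviving root can reach the new hyperedge only through p, so two roots merged by it
      -- already shared the hypertree of p.
      have key : ∀ s ∈ R, s ∉ B → ∀ a ∈ insert p B, (linkGraph E).Reachable s a → a = p := by
        intro s hs hsB a ha hsa
        rcases Finset.mem_insert.1 ha with rfl | ha
        · rfl
        · exact (hsB (h.eq_of_reachable hs (hB ha) hsa ▸ ha)).elim
      rcases reachable_insert (hxs.symm.trans hxt) with hst | ⟨⟨a, ha, hsa⟩, b, hb, htb⟩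
      · exact h.eq_of_reachable hs.1 ht.1 hst
      · rw [key s hs.1 hs.2 a ha hsa] at hsa
        rw [key t ht.1 ht.2 b hb htb] at htb
        exact h.eq_of_reachable hs.1 ht.1 (hsa.trans htb.symm)

/-- Every hyperedge of a rooted hyperforest arises by `insert_edge`. -/
theorem erase_edge (h : IsRooted E R) {f : Finset V} (hf : f ∈ E) :
    ∃ p B, B.Nonempty ∧ Disjoint R B ∧ f = insert p B ∧ IsRooted (E.erase f) (R ∪ B) ∧
      ∀ b ∈ B, ¬ (linkGraph (E.erase f)).Reachable p b := by
  have hE := Finset.insert_erase hf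
  have hfE := Finset.notMem_erase f E
  set E' := E.erase f
  have hmono : linkGraph E' ≤ linkGraph E := linkGraph_mono (Finset.erase_subset _ _)
  have hind : ∀ x ∈ f, ∀ y ∈ f, (linkGraph E').Reachable x y → x = y := by
    intro x hx y hy hxy
    by_contra hne
    exact not_reachable_of_isHyperforest_insert hfE (hE.symm ▸ h.isHyperforest) hx hy hne hxy
  have h2 := h.two_le_card f hf
  have hreach : ∀ {x y}, (linkGraph E).Reachable x y → (linkGraph E').Reachable x y ∨
      (∃ a ∈ f, (linkGraph E').Reachable x a) ∧ ∃ b ∈ f, (linkGraph E').Reachable y b :=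
    fun {x y} hxy => reachable_insert (by rwa [hE])
  obtain ⟨a₀, ha₀⟩ : f.Nonempty := Finset.card_pos.1 (by omega)
  obtain ⟨ρ, ⟨hρ, hρa⟩, hρu⟩ := h.existsUnique_root a₀
  -- p is the vertex of f that stays with the old root ρ.
  obtain ⟨p, hpf, hpρ⟩ : ∃ p ∈ f, (linkGraph E').Reachable ρ p := by
    rcases hreach hρa.symm with h1 | ⟨h1, -⟩
    · exact ⟨a₀, ha₀, h1⟩
    · exact h1
  have hroot : ∀ s ∈ R, ∀ b ∈ f, (linkGraph E).Reachable s b → s = ρ := fun s hs b hb hsb =>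
    hρu s ⟨hs, ((reachable_of_mem hf ha₀ hb).trans hsb.symm)⟩
  have hpart : ∀ s ∈ R, ∀ b ∈ f, (linkGraph E').Reachable s b → b = p := by
    intro s hs b hb hsb
    have := hroot s hs b hb (hsb.mono hmono)
    subst this
    exact hind b hb p hpf (hsb.symm.trans hpρ)
  have hins : insert p (f.erase p) = f := Finset.insert_erase hpf
  refine ⟨p, f.erase p, ?_, ?_, hins.symm, ⟨?_, isHyperforest_mono (Finset.erase_subset _ _)
    h.isHyperforest, fun x => ?_⟩, ?_⟩
  · rw [← Finset.card_pos, Finset.card_erase_of_mem hpf]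
    omega
  · rw [Finset.disjoint_left]
    intro s hs hsf
    exact Finset.ne_of_mem_erase hsf
      (hpart s hs s (Finset.mem_of_mem_erase hsf) (SimpleGraph.Reachable.refl _))
  · exact fun g hg => h.two_le_card g (Finset.mem_of_mem_erase hg)
  · apply existsUnique_of_exists_of_unique
    · obtain ⟨s, ⟨hs, hxs⟩, -⟩ := h.existsUnique_root x
      rcases hreach hxs with h1 | ⟨⟨a, ha, hxa⟩, b, hb, hsb⟩
      · exact ⟨s, Finset.mem_union_left _ hs, h1⟩
      · by_cases hap : a = p
        · subst hap
          exact ⟨ρ, Finset.mem_union_left _ hρ, hxa.trans hpρ.symm⟩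
        · exact ⟨a, Finset.mem_union_right _ (Finset.mem_erase.2 ⟨hap, ha⟩), hxa⟩
    · rintro s t ⟨hs, hxs⟩ ⟨ht, hxt⟩
      have hst := hxs.symm.trans hxt
      rcases Finset.mem_union.1 hs with hs | hs <;> rcases Finset.mem_union.1 ht with ht | ht
      · exact h.eq_of_reachable hs ht (hst.mono hmono)
      · exact (Finset.ne_of_mem_erase ht (hpart s hs t (Finset.mem_of_mem_erase ht) hst)).elim
      · exact (Finset.ne_of_mem_erase hs (hpart t ht s (Finset.mem_of_mem_erase hs) hst.symm)).elim
      · exact hind s (Finset.mem_of_mem_erase hs) t (Finset.mem_of_mem_erase ht) hst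
  · intro b hb hpb
    exact Finset.ne_of_mem_erase hb (hind p hpf b (Finset.mem_of_mem_erase hb) hpb).symm

/-- Otherwise p lies in B', hence is itself a root for R ∪ B'. Its root for R ∪ B is not in B, and
if in R it would equal p, contradicting disjointness. -/
theorem parent_unique {B B' : Finset V} {p p' : V} (h : IsRooted E (R ∪ B))
    (h' : IsRooted E (R ∪ B')) (hp : ∀ b ∈ B, ¬ (linkGraph E).Reachable p b)
    (hd' : Disjoint R B') (he : insert p B = insert p' B') : p = p' := by
  by_contra hne
  have hpB' : p ∈ B' := by
    have : p ∈ insert p' B' := he ▸ Finset.mem_insert_self _ _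
    exact (Finset.mem_insert.1 this).resolve_left hne
  obtain ⟨s, ⟨hs, hps⟩, -⟩ := h.existsUnique_root p
  rcases Finset.mem_union.1 hs with hs | hs
  · have := h'.eq_of_reachable (Finset.mem_union_right _ hpB') (Finset.mem_union_left _ hs) hps
    subst this
    exact Finset.disjoint_left.1 hd' hs hpB'
  · exact hp s hs hps

end IsRooted

/-! ### The recursion on the number of hyperedges -/

open Classical in
/-- The rooted hyperforests on `V` with `m` hyperedges and `r` roots. -/
noncomputable def rootedFinset (V : Type*) [Fintype V] (m r : ℕ) :
    Finset (Finset (Finset V) × Finset V) :=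
  {q | IsRooted q.1 q.2 ∧ q.1.card = m ∧ q.2.card = r}

theorem card_unreachable_roots {E : Finset (Finset V)} {R : Finset V} (h : IsRooted E R) (p : V)
    [DecidablePred fun s => ¬ (linkGraph E).Reachable p s] :
    (R.filter fun s => ¬ (linkGraph E).Reachable p s).card = R.card - 1 := by
  classical
  obtain ⟨s, ⟨hs, hps⟩, hu⟩ := h.existsUnique_root p
  rw [← Finset.card_erase_of_mem hs]
  congr 1
  ext t
  simp only [Finset.mem_filter, Finset.mem_erase]
  constructor
  · rintro ⟨ht, hpt⟩
    exact ⟨fun hts => hpt (hts ▸ hps), ht⟩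
  · rintro ⟨hts, ht⟩
    exact ⟨ht, fun hpt => hts (hu t ⟨ht, hpt⟩)⟩

open Classical in
theorem rootedFinset_succ [Fintype V] (m r : ℕ) :
    (m + 1) * (rootedFinset V (m + 1) r).card =
      ∑ k ∈ Finset.Icc 1 (Fintype.card V - r),
        (rootedFinset V m (r + k)).card * (Fintype.card V * (r + k - 1).choose k) := by
  have hl : (m + 1) * (rootedFinset V (m + 1) r).card =
      ((rootedFinset V (m + 1) r).sigma fun q => q.1).card := by
    rw [Finset.card_sigma, Finset.sum_congr rfl (g := fun _ => m + 1), Finset.sum_const,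
      smul_eq_mul, mul_comm]
    intro q hq
    exact (Finset.mem_filter.1 hq).2.2.1
  have hr : ∑ k ∈ Finset.Icc 1 (Fintype.card V - r),
        (rootedFinset V m (r + k)).card * (Fintype.card V * (r + k - 1).choose k) =
      ((Finset.Icc 1 (Fintype.card V - r)).sigma fun k => (rootedFinset V m (r + k)).sigma fun q =>
        (Finset.univ : Finset V).sigma fun p =>
          (q.2.filter fun s => ¬ (linkGraph q.1).Reachable p s).powersetCard k).card := by
    simp only [Finset.card_sigma, Finset.card_powersetCard]
    refine Finset.sum_congr rfl fun k _ => ?_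
    rw [← smul_eq_mul, ← Finset.sum_const]
    refine Finset.sum_congr rfl fun q hq => ?_
    obtain ⟨hq, -, hqr⟩ := (Finset.mem_filter.1 hq).2
    rw [Finset.sum_congr rfl fun p _ => by rw [card_unreachable_roots hq p, hqr],
      Finset.sum_const, Finset.card_univ, smul_eq_mul]
  rw [hl, hr]
  symm
  refine Finset.card_bij
    (fun x _ => ⟨(insert (insert x.2.2.1 x.2.2.2) x.2.1.1, x.2.1.2 \ x.2.2.2),
      insert x.2.2.1 x.2.2.2⟩) ?_ ?_ ?_
  · rintro ⟨k, ⟨E, R⟩, p, B⟩ hx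
    simp only [Finset.mem_sigma, Finset.mem_Icc, rootedFinset, Finset.mem_filter, Finset.mem_univ,
      true_and, Finset.mem_powersetCard, Finset.subset_iff] at hx ⊢
    obtain ⟨⟨hk, -⟩, ⟨hER, hE, hR⟩, hB, hBk⟩ := hx
    have hne : B.Nonempty := Finset.card_pos.1 (by omega)
    refine ⟨⟨hER.insert_edge (fun b hb => (hB hb).1) hne fun b hb => (hB hb).2, ?_, ?_⟩,
      Finset.mem_insert_self _ _⟩
    · rw [Finset.card_insert_of_notMem (IsRooted.insert_notMem hne fun b hb => (hB hb).2), hE]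
    · rw [Finset.card_sdiff_of_subset (fun b hb => (hB hb).1)]
      omega
  · rintro ⟨k, ⟨E, R⟩, p, B⟩ hx ⟨k', ⟨E', R'⟩, p', B'⟩ hx' heq
    simp only [Finset.mem_sigma, Finset.mem_Icc, rootedFinset, Finset.mem_filter, Finset.mem_univ,
      true_and, Finset.mem_powersetCard, Finset.subset_iff] at hx hx'
    obtain ⟨⟨hk, -⟩, ⟨hER, hE, hR⟩, hB, hBk⟩ := hx
    obtain ⟨⟨hk', -⟩, ⟨hER', hE', hR'⟩, hB', hBk'⟩ := hx'
    simp only [Sigma.mk.injEq, Prod.mk.injEq, heq_eq_eq] at heq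
    obtain ⟨⟨h1, h2⟩, h3⟩ := heq
    have hn := IsRooted.insert_notMem (Finset.card_pos.1 (by omega)) fun b hb => (hB hb).2
    have hn' := IsRooted.insert_notMem (Finset.card_pos.1 (by omega)) fun b hb => (hB' hb).2
    -- The data are recovered in turn: E by erasing the marked hyperedge, then p by `parent_unique`,
    -- then B, and finally R.
    have hEE : E = E' := by
      rw [← Finset.erase_insert hn, ← Finset.erase_insert hn', h1, h3]
    subst hEE
    have hRB : R = (R \ B) ∪ B := (Finset.sdiff_union_of_subset fun b hb => (hB hb).1).symm
    have hRB' : R' = (R \ B) ∪ B' := by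
      rw [h2]; exact (Finset.sdiff_union_of_subset fun b hb => (hB' hb).1).symm
    have hpB := IsRooted.notMem_of_forall_not_reachable fun b hb => (hB hb).2
    have hpB' := IsRooted.notMem_of_forall_not_reachable fun b hb => (hB' hb).2
    have hpp : p = p' := IsRooted.parent_unique (hRB ▸ hER) (hRB' ▸ hER')
      (fun b hb => (hB hb).2) (h2 ▸ Finset.sdiff_disjoint) h3
    subst hpp
    have hBB : B = B' := by
      rw [← Finset.erase_insert hpB, ← Finset.erase_insert hpB', h3]
    subst hBB
    rw [hRB, hRB', ← hBk, ← hBk']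
  · rintro ⟨⟨E, R⟩, f⟩ hx
    simp only [Finset.mem_sigma, rootedFinset, Finset.mem_filter, Finset.mem_univ,
      true_and] at hx
    obtain ⟨⟨hER, hE, hR⟩, hf⟩ := hx
    obtain ⟨p, B, hne, hd, rfl, hER', hpB⟩ := hER.erase_edge hf
    have hc := Finset.card_union_of_disjoint hd
    have hle := Finset.card_le_univ (R ∪ B)
    have hpos := hne.card_pos
    refine ⟨⟨B.card, (E.erase (insert p B), R ∪ B), p, B⟩, ?_, ?_⟩
    · simp only [Finset.mem_sigma, Finset.mem_Icc, rootedFinset, Finset.mem_filter,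
        Finset.mem_univ, true_and, Finset.mem_powersetCard, Finset.subset_iff]
      refine ⟨⟨hpos, by omega⟩, ⟨hER', ?_, by omega⟩,
        fun b hb => ⟨Finset.mem_union_right _ hb, hpB b hb⟩, trivial⟩
      rw [Finset.card_erase_of_mem hf]
      omega
    · simp only [Finset.insert_erase hf, Finset.union_sdiff_cancel_right hd]

theorem rootedFinset_zero [Fintype V] (r : ℕ) :
    (rootedFinset V 0 r).card = if r = Fintype.card V then 1 else 0 := by
  have hbot : linkGraph (∅ : Finset (Finset V)) = ⊥ := by
    ext x y; simp [linkGraph]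
  have hmem : ∀ q, q ∈ rootedFinset V 0 r ↔ q = (∅, Finset.univ) ∧ r = Fintype.card V := by
    rintro ⟨E, R⟩
    simp only [rootedFinset, Finset.mem_filter, Finset.mem_univ, true_and, Prod.mk.injEq,
      Finset.card_eq_zero]
    constructor
    · rintro ⟨h, rfl, rfl⟩
      have : R = Finset.univ := by
        refine Finset.eq_univ_iff_forall.2 fun x => ?_
        obtain ⟨s, ⟨hs, hxs⟩, -⟩ := h.existsUnique_root x
        rw [hbot, SimpleGraph.reachable_bot] at hxs
        exact hxs ▸ hs
      subst this
      simp
    · rintro ⟨⟨rfl, rfl⟩, rfl⟩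
      refine ⟨⟨by simp, ?_, fun x => ?_⟩, rfl, Finset.card_univ⟩
      · rintro k v e ⟨hw, h2, -⟩
        obtain ⟨f, hf, -⟩ := hw.edge_mem ⟨0, by omega⟩
        simp at hf
      · simp [hbot, SimpleGraph.reachable_bot]
  split_ifs with hr
  · rw [Finset.card_eq_one]
    exact ⟨(∅, Finset.univ), by ext q; rw [hmem, Finset.mem_singleton, and_iff_left hr]⟩
  · rw [Finset.card_eq_zero]
    ext q; simp [hmem, hr]

end Hypergraph

/-! ### Stirling numbers and Bell polynomials -/

theorem stirlingSecond_succ_succ_eq_sum (N m : ℕ) :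
    Nat.stirlingSecond (N + 1) (m + 1) =
      ∑ k ∈ Finset.range (N + 1), N.choose k * Nat.stirlingSecond k m := by
  induction N generalizing m with
  | zero => cases m <;> simp [Nat.stirlingSecond]
  | succ N ih =>
    have hstep : ∑ k ∈ Finset.range (N + 1 + 1), (N + 1).choose k * Nat.stirlingSecond k m =
        ∑ k ∈ Finset.range (N + 1), N.choose k * Nat.stirlingSecond k m +
          ∑ k ∈ Finset.range (N + 1), N.choose k * Nat.stirlingSecond (k + 1) m := by
      rw [Finset.sum_range_succ']
      simp only [Nat.choose_succ_succ, add_mul, Finset.sum_add_distrib]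
      have h1 := Finset.sum_range_succ' (fun k => N.choose k * Nat.stirlingSecond k m) (N + 1)
      rw [Finset.sum_range_succ] at h1
      simp only [Nat.choose_succ_self, zero_mul, Nat.choose_zero_right, Nat.succ_eq_add_one] at h1 ⊢
      omega
    rw [hstep, ← ih, Nat.stirlingSecond_succ_succ]
    cases m with
    | zero => simp
    | succ m =>
      simp only [Nat.stirlingSecond_succ_succ _ m, mul_add, Finset.sum_add_distrib, ← ih m]
      have : ∑ k ∈ Finset.range (N + 1), N.choose k * ((m + 1) * Nat.stirlingSecond k (m + 1)) =
          (m + 1) * Nat.stirlingSecond (N + 1) (m + 1 + 1) := by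
        rw [ih (m + 1), Finset.mul_sum]
        exact Finset.sum_congr rfl fun k _ => by ring
      rw [this]
      ring

/-- Both sides count partitions with a marked block, of size k. Formally, the two-term recurrence
cancels the k = 0 term of the preceding identity. -/
theorem succ_mul_stirlingSecond_succ (N m : ℕ) :
    (m + 1) * Nat.stirlingSecond N (m + 1) =
      ∑ k ∈ Finset.Icc 1 N, N.choose k * Nat.stirlingSecond (N - k) m := by
  have h := stirlingSecond_succ_succ_eq_sum N m
  rw [Nat.stirlingSecond_succ_succ, ← Finset.sum_range_reflect, Finset.sum_range_succ'] at h
  simp only [Nat.add_sub_cancel, Nat.sub_zero, Nat.choose_self, one_mul] at h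
  rw [← Finset.sum_Ico_add' (fun k => N.choose k * Nat.stirlingSecond (N - k) m) 0 N 1 |>.trans
    (by rfl : _ = ∑ k ∈ Finset.Icc 1 N, N.choose k * Nat.stirlingSecond (N - k) m),
    Nat.Ico_zero_eq_range]
  rw [Nat.add_right_cancel h]
  refine Finset.sum_congr rfl fun k hk => ?_
  have := Finset.mem_range.1 hk
  rw [Nat.choose_symm (by omega)]

theorem bellPolynomial_eval (s x : ℕ) :
    (bellPolynomial s).eval x =
      ∑ m ∈ Finset.range (s + 1), Nat.stirlingSecond s m * x ^ m := by
  simp [bellPolynomial, Polynomial.eval_finsetSum]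

theorem bellPolynomial_eval_of_le {s M : ℕ} (h : s ≤ M) (x : ℕ) :
    (bellPolynomial s).eval x =
      ∑ m ∈ Finset.range (M + 1), Nat.stirlingSecond s m * x ^ m := by
  rw [bellPolynomial_eval]
  refine Finset.sum_subset (Finset.range_mono (by omega)) fun m _ hm => ?_
  rw [Nat.stirlingSecond_eq_zero_of_lt (by simpa using hm), zero_mul]

theorem bellPolynomial_eval_succ (N x : ℕ) :
    (bellPolynomial (N + 1)).eval x =
      x * ∑ k ∈ Finset.range (N + 1), N.choose k * (bellPolynomial k).eval x := by
  rw [bellPolynomial_eval, Finset.sum_range_succ']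
  simp only [stirlingSecond_succ_succ_eq_sum, Nat.stirlingSecond_succ_zero, zero_mul, add_zero,
    Finset.sum_mul, Finset.mul_sum]
  rw [Finset.sum_comm]
  refine Finset.sum_congr rfl fun k hk => ?_
  rw [bellPolynomial_eval_of_le (Nat.lt_succ_iff.1 (Finset.mem_range.1 hk)), Finset.mul_sum,
    Finset.mul_sum]
  exact Finset.sum_congr rfl fun m _ => by ring

theorem sum_choose_mul_bellPolynomial (N x : ℕ) :
    x * ∑ r ∈ Finset.Icc 1 (N + 1), N.choose (r - 1) * (bellPolynomial (N + 1 - r)).eval x =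
      (bellPolynomial (N + 1)).eval x := by
  rw [bellPolynomial_eval_succ, ← Finset.sum_range_reflect]
  congr 1
  refine (Finset.sum_Ico_add' (fun r => N.choose (r - 1) * (bellPolynomial (N + 1 - r)).eval x)
    0 (N + 1) 1).symm.trans ?_
  rw [Nat.Ico_zero_eq_range]
  refine Finset.sum_congr rfl fun k hk => ?_
  have := Finset.mem_range.1 hk
  rw [show N + 1 - 1 - k = N - k by omega, show N + 1 - (k + 1) = N - k by omega,
    Nat.choose_symm (by omega), Nat.add_sub_cancel]

/-! ### The closed formula by number of hyperedges and roots -/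

namespace Hypergraph

/-- The case r = 0 is excluded because r - 1 truncates: no rooted hyperforest exists there, yet the
formula need not vanish. -/
theorem card_rootedFinset {V : Type*} [Fintype V] [Nonempty V] (m : ℕ) {r : ℕ} (hr : 1 ≤ r) :
    (rootedFinset V m r).card = (Fintype.card V - 1).choose (r - 1) *
      (Nat.stirlingSecond (Fintype.card V - r) m * Fintype.card V ^ m) := by
  have hn : 0 < Fintype.card V := Fintype.card_pos
  induction m generalizing r with
  | zero =>
    rw [rootedFinset_zero]
    rcases lt_trichotomy r (Fintype.card V) with h | h | h
    · obtain ⟨d, hd⟩ : ∃ d, Fintype.card V - r = d + 1 := ⟨Fintype.card V - r - 1, by omega⟩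
      simp [h.ne, hd]
    · simp [h]
    · rw [Nat.choose_eq_zero_of_lt (by omega)]
      simp [h.ne']
  | succ m ih =>
    refine Nat.eq_of_mul_eq_mul_left (Nat.succ_pos m) ?_
    rw [Nat.succ_eq_add_one, rootedFinset_succ]
    set n := Fintype.card V
    rw [show (m + 1) * ((n - 1).choose (r - 1) * (Nat.stirlingSecond (n - r) (m + 1) *
        n ^ (m + 1))) = (n - 1).choose (r - 1) * n ^ (m + 1) *
        ((m + 1) * Nat.stirlingSecond (n - r) (m + 1)) by ring, succ_mul_stirlingSecond_succ,
      Finset.mul_sum]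
    refine Finset.sum_congr rfl fun k hk => ?_
    have hk' := Finset.mem_Icc.1 hk
    rw [ih (by omega)]
    -- This becomes C(n-1, r+k-1) C(r+k-1, k) = C(n-1, r-1) C(n-r, k), matching the sums term by
    -- term.
    have hch := Nat.choose_mul (n := n - 1) (k := r + k - 1) (s := r - 1) (by omega)
    rw [show r + k - 1 - (r - 1) = k by omega, show n - 1 - (r - 1) = n - r by omega,
      ← Nat.choose_symm (by omega : r - 1 ≤ r + k - 1), show r + k - 1 - (r - 1) = k by omega]
      at hch
    rw [show n - r - k = n - (r + k) by omega]
    calc _ = (n - 1).choose (r + k - 1) * (r + k - 1).choose k *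
          (Nat.stirlingSecond (n - (r + k)) m * n ^ (m + 1)) := by ring
      _ = _ := by rw [hch]; ring

end Hypergraph

/-! ### Transfer to sets of hypergraphs and summation -/

namespace Hypergraph

theorem componentSets_ofEdges {V : Type*} (E : Finset (Finset V)) :
    (ofEdges E).componentSets = Set.range fun x => {y | (linkGraph E).Reachable x y} := by
  ext C
  simp only [componentSets, walkConnected_ofEdges_iff, Set.mem_ofPred_eq, Set.mem_range]
  exact ⟨fun ⟨x, _, h⟩ => ⟨x, h.symm⟩, fun ⟨x, h⟩ => ⟨x, Set.mem_univ _, h.symm⟩⟩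

theorem IsRooted.ncard_componentSets {V : Type*} {E : Finset (Finset V)} {R : Finset V}
    (h : IsRooted E R) : (ofEdges E).componentSets.ncard = R.card := by
  rw [← Set.ncard_coe_finset, componentSets_ofEdges]
  have : (Set.range fun x => {y | (linkGraph E).Reachable x y}) =
      (fun x => {y | (linkGraph E).Reachable x y}) '' (R : Set V) := by
    refine Set.Subset.antisymm ?_ (Set.image_subset_range _ _)
    rintro _ ⟨x, rfl⟩
    obtain ⟨s, ⟨hs, hxs⟩, -⟩ := h.existsUnique_root x
    exact ⟨s, hs, Set.ext fun y => ⟨fun hy => hxs.trans hy, fun hy => hxs.symm.trans hy⟩⟩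
  rw [this]
  refine Set.InjOn.ncard_image fun s hs t ht hst => ?_
  have : t ∈ {y | (linkGraph E).Reachable s y} := by
    rw [show {y | (linkGraph E).Reachable s y} = {y | (linkGraph E).Reachable t y} from hst]
    exact SimpleGraph.Reachable.refl _
  exact h.eq_of_reachable hs ht this

theorem mem_rootedSpanningHyperforests_iff {n : ℕ} {E : Finset (Finset (Fin n))}
    {R : Finset (Fin n)} :
    (ofEdges E, (R : Set (Fin n))) ∈ (completeHypergraph n).rootedSpanningHyperforests ↔
      IsRooted E R := by
  simp only [rootedSpanningHyperforests, Set.mem_ofPred_eq, componentSets_ofEdges,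
    Set.forall_mem_range]
  constructor
  · rintro ⟨⟨-, hE⟩, hF, -, hR⟩
    refine ⟨fun f hf => ?_, hF, fun x => hR x⟩
    have : (f : Set (Fin n)) ∈ (completeHypergraph n).edgeSet := hE ⟨f, hf, rfl⟩
    simpa [completeHypergraph] using this
  · rintro ⟨h2, hF, hR⟩
    refine ⟨⟨rfl, ?_⟩, hF, Set.subset_univ _, fun x => hR x⟩
    rintro _ ⟨f, hf, rfl⟩
    simpa [completeHypergraph] using h2 f hf

theorem ofEdges_injective {V : Type*} : Function.Injective (ofEdges (V := V)) := by
  have : ∀ E E' : Finset (Finset V), ofEdges E = ofEdges E' → E ⊆ E' := by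
    intro E E' h f hf
    have hm : (f : Set V) ∈ (ofEdges E).edgeSet := ⟨f, hf, rfl⟩
    rw [h] at hm
    obtain ⟨g, hg, hfg⟩ := hm
    rwa [Finset.coe_injective hfg]
  exact fun E E' h => (this E E' h).antisymm (this E' E h.symm)

theorem exists_ofEdges_eq {V : Type*} [Finite V] (H : Hypergraph V) (h : H.vertexSet = Set.univ) :
    ∃ E, ofEdges E = H := by
  refine ⟨(Set.toFinite {f : Finset V | (f : Set V) ∈ H.edgeSet}).toFinset,
    Hypergraph.ext h.symm (Set.ext fun A => ?_)⟩
  simp only [ofEdges, Set.Finite.mem_toFinset, Set.mem_ofPred_eq]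
  constructor
  · rintro ⟨f, hf, rfl⟩
    exact hf
  · intro hA
    exact ⟨A.toFinite.toFinset, by simpa using hA, by simp⟩

open Classical in
-- The predicate P lets one bijection serve both the count with r hypertrees and the total count.
theorem ncard_subset_rootedSpanningHyperforests (n : ℕ) (P : ℕ → Prop) :
    {p ∈ (completeHypergraph n).rootedSpanningHyperforests |
        P p.1.componentSets.ncard}.ncard =
      (Finset.univ.filter fun q : Finset (Finset (Fin n)) × Finset (Fin n) =>
        IsRooted q.1 q.2 ∧ P q.2.card).card := by
  rw [← Set.ncard_coe_finset]
  symm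
  refine Set.ncard_congr (fun q _ => (ofEdges q.1, (q.2 : Set (Fin n)))) ?_ ?_ ?_
  · rintro ⟨E, R⟩ hq
    simp only [Finset.coe_filter, Finset.mem_univ, true_and, Set.mem_ofPred_eq] at hq
    exact ⟨mem_rootedSpanningHyperforests_iff.2 hq.1, hq.1.ncard_componentSets.symm ▸ hq.2⟩
  · rintro ⟨E, R⟩ ⟨E', R'⟩ - - h
    rw [Prod.mk.injEq] at h
    exact Prod.ext (ofEdges_injective h.1) (Finset.coe_injective h.2)
  · rintro ⟨H, S⟩ ⟨hp, hP⟩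
    obtain ⟨E, rfl⟩ := exists_ofEdges_eq H hp.1.1
    obtain ⟨R, rfl⟩ : ∃ R : Finset (Fin n), (R : Set (Fin n)) = S :=
      ⟨S.toFinite.toFinset, by simp⟩
    have h := mem_rootedSpanningHyperforests_iff.1 hp
    exact ⟨(E, R), by simpa using ⟨h, h.ncard_componentSets ▸ hP⟩, rfl⟩

open Classical in
theorem card_isRooted_filter {n : ℕ} (hn : 1 ≤ n) {r : ℕ} (hr : 1 ≤ r) :
    (Finset.univ.filter fun q : Finset (Finset (Fin n)) × Finset (Fin n) =>
        IsRooted q.1 q.2 ∧ q.2.card = r).card =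
      (n - 1).choose (r - 1) * (bellPolynomial (n - r)).eval n := by
  have : Nonempty (Fin n) := ⟨⟨0, hn⟩⟩
  have hcard : ∀ m, (rootedFinset (Fin n) m r).card =
      (n - 1).choose (r - 1) * (Nat.stirlingSecond (n - r) m * n ^ m) := fun m => by
    simpa using card_rootedFinset (V := Fin n) m hr
  rw [bellPolynomial_eval, Finset.mul_sum, Finset.card_eq_sum_card_fiberwise
    (f := fun q => q.1.card) (t := Finset.range (n - r + 1))]
  · refine Finset.sum_congr rfl fun m _ => ?_
    rw [← hcard, rootedFinset, Finset.filter_filter]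
    congr 1
    ext q
    simp only [Finset.mem_filter, Finset.mem_univ, true_and]
    tauto
  · rintro q hq
    have hq := (Finset.mem_filter.1 hq).2
    have hmem : q ∈ rootedFinset (Fin n) q.1.card r :=
      Finset.mem_filter.2 ⟨Finset.mem_univ _, hq.1, rfl, hq.2⟩
    rw [Finset.mem_coe, Finset.mem_range]
    -- With more than n - r hyperedges the Stirling number vanishes, so the fibre would be empty.
    by_contra hlt
    have := Finset.card_pos.2 ⟨q, hmem⟩
    rw [hcard, Nat.stirlingSecond_eq_zero_of_lt (by simpa using hlt)] at this
    simp at this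

theorem ncard_rootedSpanningHyperforestsWith {n : ℕ} (hn : 1 ≤ n) {r : ℕ} (hr : 1 ≤ r) :
    ((completeHypergraph n).rootedSpanningHyperforestsWith r).ncard =
      (n - 1).choose (r - 1) * (bellPolynomial (n - r)).eval n := by
  rw [← card_isRooted_filter hn hr]
  convert ncard_subset_rootedSpanningHyperforests n (· = r)
  rfl

open Classical in
theorem ncard_rootedSpanningHyperforests {n : ℕ} (hn : 1 ≤ n) :
    (completeHypergraph n).rootedSpanningHyperforests.ncard =
      ∑ r ∈ Finset.Icc 1 n, (n - 1).choose (r - 1) * (bellPolynomial (n - r)).eval n := by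
  have h := ncard_subset_rootedSpanningHyperforests n fun _ => True
  simp only [and_true, Set.ofPred_mem_eq] at h
  rw [h, Finset.card_eq_sum_card_fiberwise (f := fun q => q.2.card) (t := Finset.Icc 1 n)]
  · refine Finset.sum_congr rfl fun r hr => ?_
    rw [Finset.filter_filter, card_isRooted_filter hn (Finset.mem_Icc.1 hr).1]
  · rintro q hq
    have hq := (Finset.mem_filter.1 hq).2
    obtain ⟨s, ⟨hs, -⟩, -⟩ := hq.existsUnique_root ⟨0, hn⟩
    rw [Finset.mem_coe, Finset.mem_Icc]
    exact ⟨Finset.card_pos.2 ⟨s, hs⟩, by simpa using Finset.card_le_univ q.2⟩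

end Hypergraph

theorem mainTheorem7 (n : ℕ) (hn : 1 ≤ n) :
    (∀ r : ℕ, 1 ≤ r → r ≤ n →
      ((Hypergraph.completeHypergraph n).rootedSpanningHyperforestsWith r).ncard
          = (n - 1).choose (r - 1) * (bellPolynomial (n - r)).eval n ∧
      ((Hypergraph.completeHypergraph n).rootedSpanningHyperforestsWith r).ncard
          = (n - 1).choose (r - 1) *
              ∑ m ∈ Finset.range (n - r + 1), Nat.stirlingSecond (n - r) m * n ^ m) ∧
    (Hypergraph.completeHypergraph n).rootedSpanningHyperforests.ncard
        = ∑ r ∈ Finset.Icc 1 n, (n - 1).choose (r - 1) * (bellPolynomial (n - r)).eval n ∧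
    ((Hypergraph.completeHypergraph n).rootedSpanningHyperforests.ncard : ℚ)
        = (((bellPolynomial n).eval n : ℕ) : ℚ) / (n : ℚ) := by

  refine ⟨fun r hr _ => ⟨Hypergraph.ncard_rootedSpanningHyperforestsWith hn hr, ?_⟩,
    Hypergraph.ncard_rootedSpanningHyperforests hn, ?_⟩
  · rw [Hypergraph.ncard_rootedSpanningHyperforestsWith hn hr, bellPolynomial_eval]
  · rw [Hypergraph.ncard_rootedSpanningHyperforests hn, eq_div_iff (by positivity)]
    obtain ⟨N, rfl⟩ : ∃ N, n = N + 1 := ⟨n - 1, by omega⟩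
    rw [← sum_choose_mul_bellPolynomial N (N + 1), Nat.add_sub_cancel, mul_comm]
    push_cast
    rfl
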